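/- All manifolds are smooth, connected, without boundary, Hausdorff and second countable; metrics and vector fields are smooth, Lorentzian metrics have signature $(-,+,\dots,+)$, and a null vector field is required to be nowhere vanishing. Let $(M,g)$ be a Lorentzian manifold. A vector field $\xi$ on $M$ is hypersurface-orthogonal if near every point there is a smooth function $f$ with $df\neq 0$ everywhere such that $\xi$ is orthogonal to the level sets of $f$ (equivalently, locally $g(\xi,\cdot)=\Omega\,df$). A wave vector field is a hypersurface-orthogonal, null and complete vector field, and $(M,g)$ is a gravitational wave if it possesses a wave vector field. $(M,g)$ is a Platonic wave if it possesses a complete null Killing vector field $\xi$ that becomes parallel for a (locally) conformally related metric: every point of $M$ has an open neighbourhood $U$ with a smooth function $\Omega>0$ on $U$ such that $\bar\nabla\xi=0$ on $U$, where $\bar\nabla$ is the Levi-Civita connection of $\bar g=\Omega^{-1}g$. **Proposition.** $(M,g)$ is a gravitational wave possessing a wave vector field that is Killing if and only if $(M,g)$ is a Platonic wave. -/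

import Mathlib

open scoped Manifold ContDiff Topology

/-! ### Vector fields, bilinear forms and their derivatives

`M` is a smooth manifold of dimension `D` without boundary, modelled on Euclidean `D`-space. -/

section Basics

variable {D : ℕ} {M : Type*} [TopologicalSpace M] [ChartedSpace (EuclideanSpace ℝ (Fin D)) M]
  [IsManifold (𝓡 D) ∞ M]

/-- The vector field `X` is smooth at the point `x`. -/
def SmoothFieldAt (X : (x : M) → TangentSpace (𝓡 D) x) (x : M) : Prop :=
  ContMDiffAt (𝓡 D) (𝓡 D).tangent ∞ (fun y => (⟨y, X y⟩ : TangentBundle (𝓡 D) M)) x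

/-- The vector field `X` is complete: through every point of `M` there is an integral curve of `X`
that is defined on all of `ℝ`. -/
def IsCompleteField (X : (x : M) → TangentSpace (𝓡 D) x) : Prop :=
  ∀ p : M, ∃ γ : ℝ → M, γ 0 = p ∧ IsMIntegralCurve γ X

/-- `b(X, Y)` as a function on `M`, for a field `b` of bilinear forms and vector fields
`X`, `Y`. -/
noncomputable def pairing (b : (x : M) → TangentSpace (𝓡 D) x →L[ℝ] TangentSpace (𝓡 D) x →L[ℝ] ℝ)
    (X Y : (x : M) → TangentSpace (𝓡 D) x) : M → ℝ :=
  fun x => b x (X x) (Y x)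

/-- The derivative `X h` at `x` of a real function `h` along the vector field `X`. -/
noncomputable def dirDeriv (X : (x : M) → TangentSpace (𝓡 D) x) (h : M → ℝ) (x : M) : ℝ :=
  mvfderiv (𝓡 D) h x (X x)

/-- The Lie derivative of a field of bilinear forms, at `x`:
`(L_V b)(X, Y) = V (b(X, Y)) - b([V, X], Y) - b(X, [V, Y])`. -/
noncomputable def lieDerivForm
    (b : (x : M) → TangentSpace (𝓡 D) x →L[ℝ] TangentSpace (𝓡 D) x →L[ℝ] ℝ)
    (V X Y : (x : M) → TangentSpace (𝓡 D) x) (x : M) : ℝ :=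
  dirDeriv V (pairing b X Y) x
    - b x (VectorField.mlieBracket (𝓡 D) V X x) (Y x)
    - b x (X x) (VectorField.mlieBracket (𝓡 D) V Y x)

/-- The right-hand side of the Koszul formula at `x`:
`X b(V, Z) + V b(X, Z) - Z b(X, V) + b([X, V], Z) - b([X, Z], V) - b([V, Z], X)`. -/
noncomputable def koszul
    (b : (x : M) → TangentSpace (𝓡 D) x →L[ℝ] TangentSpace (𝓡 D) x →L[ℝ] ℝ)
    (X V Z : (x : M) → TangentSpace (𝓡 D) x) (x : M) : ℝ :=
  dirDeriv X (pairing b V Z) x + dirDeriv V (pairing b X Z) x - dirDeriv Z (pairing b X V) x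
    + b x (VectorField.mlieBracket (𝓡 D) X V x) (Z x)
    - b x (VectorField.mlieBracket (𝓡 D) X Z x) (V x)
    - b x (VectorField.mlieBracket (𝓡 D) V Z x) (X x)

/-- `w = (∇_X V)(x)` for the Levi-Civita connection `∇` of the (pseudo-Riemannian) metric `b`.
The connection is defined by the Koszul formula: `∇_X V` at `x` is the vector `w` with
`2 b(w, Z) = X b(V, Z) + V b(X, Z) - Z b(X, V) + b([X, V], Z) - b([X, Z], V) - b([V, Z], X)`
for all `Z`; it is unique because `b` is nondegenerate. -/
def IsLeviCivitaDeriv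
    (b : (x : M) → TangentSpace (𝓡 D) x →L[ℝ] TangentSpace (𝓡 D) x →L[ℝ] ℝ)
    (X V : (x : M) → TangentSpace (𝓡 D) x) (x : M) (w : TangentSpace (𝓡 D) x) : Prop :=
  ∀ Z : (x : M) → TangentSpace (𝓡 D) x, SmoothFieldAt Z x →
    2 * b x w (Z x) = koszul b X V Z x

/-- The vector field `V` is parallel on `U` for the Levi-Civita connection of `b`:
`∇_X V = 0` at the points of `U`, for all `X`. -/
def IsParallelOn
    (b : (x : M) → TangentSpace (𝓡 D) x →L[ℝ] TangentSpace (𝓡 D) x →L[ℝ] ℝ)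
    (V : (x : M) → TangentSpace (𝓡 D) x) (U : Set M) : Prop :=
  ∀ x ∈ U, ∀ X : (x : M) → TangentSpace (𝓡 D) x, SmoothFieldAt X x →
    IsLeviCivitaDeriv b X V x 0

/-- The Koszul formula gives the Levi-Civita connection: if `cov` (with `∇_X V = cov V x (X x)`)
is torsion-free and compatible with the symmetric form `b` at `x`, then `IsLeviCivitaDeriv`
computes `cov`. -/
theorem isLeviCivitaDeriv_of_torsionFree_of_metric
    (b : (x : M) → TangentSpace (𝓡 D) x →L[ℝ] TangentSpace (𝓡 D) x →L[ℝ] ℝ)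
    (b_symm : ∀ x v w, b x v w = b x w v)
    (cov : ((x : M) → TangentSpace (𝓡 D) x) →
      ((x : M) → TangentSpace (𝓡 D) x →L[ℝ] TangentSpace (𝓡 D) x))
    (x : M)
    (torsionFree : ∀ X Y : (x : M) → TangentSpace (𝓡 D) x,
      SmoothFieldAt X x → SmoothFieldAt Y x →
        cov Y x (X x) - cov X x (Y x) = VectorField.mlieBracket (𝓡 D) X Y x)
    (metric : ∀ X Y Z : (x : M) → TangentSpace (𝓡 D) x,
      SmoothFieldAt X x → SmoothFieldAt Y x → SmoothFieldAt Z x →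
        dirDeriv X (pairing b Y Z) x = b x (cov Y x (X x)) (Z x) + b x (Y x) (cov Z x (X x)))
    (X V : (x : M) → TangentSpace (𝓡 D) x) (hX : SmoothFieldAt X x) (hV : SmoothFieldAt V x) :
    IsLeviCivitaDeriv b X V x (cov V x (X x)) := by
  intro Z hZ
  unfold koszul
  rw [metric X V Z hX hV hZ, metric V X Z hV hX hZ, metric Z X V hZ hX hV,
    ← torsionFree X V hX hV, ← torsionFree X Z hX hZ, ← torsionFree V Z hV hZ]
  simp only [map_sub, sub_apply]
  rw [b_symm x (V x), b_symm x (X x) (cov Z x (V x)), b_symm x (X x) (cov V x (Z x))]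
  ring

end Basics

/-! ### Lorentzian metrics -/

/-- A smooth Lorentzian metric on `M`, with signature `(-, +, …, +)`. -/
structure LorentzianMetric (D : ℕ) (M : Type*) [TopologicalSpace M]
    [ChartedSpace (EuclideanSpace ℝ (Fin D)) M] [IsManifold (𝓡 D) ∞ M] where
  /-- the bilinear form on each tangent space -/
  form : (x : M) → TangentSpace (𝓡 D) x →L[ℝ] TangentSpace (𝓡 D) x →L[ℝ] ℝ
  symm : ∀ x v w, form x v w = form x w v
  /-- there is a timelike vector with positive definite orthogonal complement -/
  signature : ∀ x, ∃ v, form x v v < 0 ∧ ∀ w, form x v w = 0 → w ≠ 0 → 0 < form x w w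
  smooth : ContMDiff (𝓡 D)
    ((𝓡 D).prod 𝓘(ℝ, EuclideanSpace ℝ (Fin D) →L[ℝ] EuclideanSpace ℝ (Fin D) →L[ℝ] ℝ)) ∞
    (fun x => Bundle.TotalSpace.mk'
      (EuclideanSpace ℝ (Fin D) →L[ℝ] EuclideanSpace ℝ (Fin D) →L[ℝ] ℝ) x (form x))

namespace LorentzianMetric

variable {D : ℕ} {M : Type*} [TopologicalSpace M] [ChartedSpace (EuclideanSpace ℝ (Fin D)) M]
  [IsManifold (𝓡 D) ∞ M]

/-- `ξ` is null and nowhere vanishing. -/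
def IsNull (g : LorentzianMetric D M) (ξ : (x : M) → TangentSpace (𝓡 D) x) : Prop :=
  ∀ x, ξ x ≠ 0 ∧ g.form x (ξ x) (ξ x) = 0

/-- `ξ` is a Killing vector field of `g`: `L_ξ g = 0`. -/
def IsKilling (g : LorentzianMetric D M) (ξ : (x : M) → TangentSpace (𝓡 D) x) : Prop :=
  ∀ (x : M) (X Y : (x : M) → TangentSpace (𝓡 D) x), SmoothFieldAt X x → SmoothFieldAt Y x →
    lieDerivForm g.form ξ X Y x = 0

/-- `ξ` is hypersurface-orthogonal: `M` is foliated by hypersurfaces orthogonal to `ξ`, that is,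
near every point there is a smooth function `f` with nowhere vanishing differential such that
`ξ` is orthogonal to the tangent space `ker df` of the level sets of `f`. -/
def IsHypersurfaceOrthogonal (g : LorentzianMetric D M)
    (ξ : (x : M) → TangentSpace (𝓡 D) x) : Prop :=
  ∀ p : M, ∃ (U : Set M) (f : M → ℝ), IsOpen U ∧ p ∈ U ∧
    ContMDiffOn (𝓡 D) 𝓘(ℝ) ∞ f U ∧
    ∀ x ∈ U, mvfderiv (𝓡 D) f x ≠ 0 ∧
      ∀ v : TangentSpace (𝓡 D) x, mvfderiv (𝓡 D) f x v = 0 → g.form x (ξ x) v = 0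

/-- A wave vector field: a smooth, nowhere vanishing vector field that is hypersurface-orthogonal,
null and complete. -/
structure IsWaveVectorField (g : LorentzianMetric D M)
    (ξ : (x : M) → TangentSpace (𝓡 D) x) : Prop where
  smooth : ∀ x, SmoothFieldAt ξ x
  null : g.IsNull ξ
  complete : IsCompleteField ξ
  hypersurfaceOrthogonal : g.IsHypersurfaceOrthogonal ξ

/-- A gravitational wave is a Lorentzian manifold that possesses a wave vector field. -/
def IsGravitationalWave (g : LorentzianMetric D M) : Prop :=
  ∃ ξ : (x : M) → TangentSpace (𝓡 D) x, g.IsWaveVectorField ξ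

/-- `ξ` becomes parallel for a conformally related metric: near every point there is a smooth
positive conformal factor `Ω` such that `ξ` is parallel for the metric `Ω⁻¹ g`. -/
def IsConformallyParallel (g : LorentzianMetric D M)
    (ξ : (x : M) → TangentSpace (𝓡 D) x) : Prop :=
  ∀ p : M, ∃ (U : Set M) (Ω : M → ℝ), IsOpen U ∧ p ∈ U ∧
    ContMDiffOn (𝓡 D) 𝓘(ℝ) ∞ Ω U ∧ (∀ x ∈ U, 0 < Ω x) ∧
    IsParallelOn (fun x => (Ω x)⁻¹ • g.form x) ξ U

/-- A Platonic wave is a Lorentzian manifold with a (smooth, nowhere vanishing, complete) null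
Killing vector field that becomes parallel for a conformally related metric. -/
def IsPlatonicWave (g : LorentzianMetric D M) : Prop :=
  ∃ ξ : (x : M) → TangentSpace (𝓡 D) x, (∀ x, SmoothFieldAt ξ x) ∧ g.IsNull ξ ∧
    IsCompleteField ξ ∧ g.IsKilling ξ ∧ g.IsConformallyParallel ξ

end LorentzianMetric

/-!
# Waves with a Killing wave vector field are Platonic waves

For a metric `b` and a vector field `V` with `b`-dual covector field `V♭ = b(V, ·)`, the
Koszul expression splits into a part symmetric and a part antisymmetric in `X` and `Z`:
`2 b(∇_X V, Z) = (L_V b)(X, Z) + dV♭(X, Z)` (`koszul_eq_lieDerivForm_add_extDerivOne`). So `V` is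
parallel if and only if it is Killing and its dual covector field is closed.

Let `ξ` be null, Killing and hypersurface-orthogonal for `g`. Locally `df = c g(ξ, ·)` with `c > 0`
smooth (`LorentzianMetric.exists_eq_smul_mvfderiv`), so that `df` is the dual of `ξ` for the
conformal metric `c g`, and it is closed. Since `ξ` is null, `df(ξ) = 0`; hence `L_ξ df = 0`. As
`L_ξ g = 0`, also `L_ξ (c g(ξ, ·)) = (ξ c) g(ξ, ·)`, and it follows that `ξ c = 0`
(`LorentzianMetric.dirDeriv_eq_zero_of_isKilling`). Thus `ξ` is Killing for `c g` too, and it is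
parallel for `c g`; the conformal factor is `Ω = c⁻¹`.

Conversely, if `ξ` is parallel for `Ω⁻¹ g`, then `Ω⁻¹ g(ξ, ·)` is closed, and the Poincaré lemma
(`exists_mvfderiv_eq_of_extDerivOne_eq_zero`) writes it locally as `df`. Then `df ≠ 0`, because `g`
is nondegenerate, and `ξ` is orthogonal to `ker df`.

The facts on covector fields (`d(df) = 0` and the Poincaré lemma) are transferred to open subsets
of Euclidean space by `extDerivOne_eq_fderiv_chartForm`, which expresses `dα` in a chart.
-/

/-! ### The exterior derivative of a covector field and the Koszul expression -/

section Calculus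

variable {D : ℕ} {M : Type*} [TopologicalSpace M] [ChartedSpace (EuclideanSpace ℝ (Fin D)) M]

/-- The exterior derivative `dα(X, Z) = X (α(Z)) - Z (α(X)) - α([X, Z])` at `x` of a field `α` of
covectors. -/
noncomputable def extDerivOne (α : (x : M) → TangentSpace (𝓡 D) x →L[ℝ] ℝ)
    (X Z : (x : M) → TangentSpace (𝓡 D) x) (x : M) : ℝ :=
  dirDeriv X (fun y => α y (Z y)) x - dirDeriv Z (fun y => α y (X y)) x
    - α x (VectorField.mlieBracket (𝓡 D) X Z x)

theorem dirDeriv_congr {X : (x : M) → TangentSpace (𝓡 D) x} {h k : M → ℝ} {x : M}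
    (e : h =ᶠ[𝓝 x] k) : dirDeriv X h x = dirDeriv X k x := by
  rw [dirDeriv, dirDeriv, mvfderiv, mvfderiv, e.mfderiv_eq, e.eq_of_nhds]

theorem dirDeriv_mul {X : (x : M) → TangentSpace (𝓡 D) x} {h k : M → ℝ} {x : M}
    (hh : MDifferentiableAt (𝓡 D) 𝓘(ℝ) h x) (hk : MDifferentiableAt (𝓡 D) 𝓘(ℝ) k x) :
    dirDeriv X (fun y => h y * k y) x = h x * dirDeriv X k x + k x * dirDeriv X h x := by
  simp [dirDeriv, mvfderiv_fun_mul hh hk]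

theorem extDerivOne_congr {α β : (x : M) → TangentSpace (𝓡 D) x →L[ℝ] ℝ} {x : M}
    (e : ∀ᶠ y in 𝓝 x, α y = β y) {X Z : (x : M) → TangentSpace (𝓡 D) x} :
    extDerivOne α X Z x = extDerivOne β X Z x := by
  have h (Y : (x : M) → TangentSpace (𝓡 D) x) :
      (fun y => α y (Y y)) =ᶠ[𝓝 x] fun y => β y (Y y) := by
    filter_upwards [e] with y hy
    rw [hy]
  rw [extDerivOne, extDerivOne, dirDeriv_congr (h Z), dirDeriv_congr (h X), e.self_of_nhds]

theorem extDerivOne_swap (α : (x : M) → TangentSpace (𝓡 D) x →L[ℝ] ℝ)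
    (X Z : (x : M) → TangentSpace (𝓡 D) x) (x : M) :
    extDerivOne α Z X x = -extDerivOne α X Z x := by
  rw [extDerivOne, extDerivOne, VectorField.mlieBracket_swap_apply (V := Z), map_neg]
  ring

theorem lieDerivForm_swap
    {b : (x : M) → TangentSpace (𝓡 D) x →L[ℝ] TangentSpace (𝓡 D) x →L[ℝ] ℝ}
    (hb : ∀ x v w, b x v w = b x w v) (V X Y : (x : M) → TangentSpace (𝓡 D) x) (x : M) :
    lieDerivForm b V Y X x = lieDerivForm b V X Y x := by
  have h : pairing b Y X = pairing b X Y := funext fun y => hb y _ _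
  rw [lieDerivForm, lieDerivForm, h, hb x _ (X x), hb x (Y x)]
  ring

/-- The Koszul expression `2 b(∇_X V, Z)` is the sum of `(L_V b)(X, Z)`, its part symmetric in
`X` and `Z`, and `d(b(V, ·))(X, Z)`, its antisymmetric part. -/
theorem koszul_eq_lieDerivForm_add_extDerivOne
    {b : (x : M) → TangentSpace (𝓡 D) x →L[ℝ] TangentSpace (𝓡 D) x →L[ℝ] ℝ}
    (hb : ∀ x v w, b x v w = b x w v) (V X Z : (x : M) → TangentSpace (𝓡 D) x) (x : M) :
    koszul b X V Z x = lieDerivForm b V X Z x + extDerivOne (fun y => b y (V y)) X Z x := by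
  have h : pairing b X V = fun y => b y (V y) (X y) := funext fun y => hb y _ _
  have h' : pairing b V Z = fun y => b y (V y) (Z y) := rfl
  rw [koszul, lieDerivForm, extDerivOne, h, h',
    VectorField.mlieBracket_swap_apply (V := X) (W := V), map_neg, neg_apply,
    hb x _ (V x), hb x _ (X x)]
  ring

theorem lieDerivForm_smul
    {b : (x : M) → TangentSpace (𝓡 D) x →L[ℝ] TangentSpace (𝓡 D) x →L[ℝ] ℝ} {c : M → ℝ} {x : M}
    (hc : MDifferentiableAt (𝓡 D) 𝓘(ℝ) c x) {V X Y : (x : M) → TangentSpace (𝓡 D) x}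
    (h : MDifferentiableAt (𝓡 D) 𝓘(ℝ) (pairing b X Y) x) :
    lieDerivForm (fun y => c y • b y) V X Y x =
      c x * lieDerivForm b V X Y x + dirDeriv V c x * b x (X x) (Y x) := by
  have h1 : pairing (fun y => c y • b y) X Y = fun y => c y * pairing b X Y y := rfl
  rw [lieDerivForm, lieDerivForm, h1, dirDeriv_mul hc h]
  simp only [smul_apply, smul_eq_mul, pairing]
  ring

end Calculus

/-! ### Vector fields and covector fields in charts -/

section Charts

variable {D : ℕ} {M : Type*} [TopologicalSpace M] [ChartedSpace (EuclideanSpace ℝ (Fin D)) M]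
  [IsManifold (𝓡 D) ∞ M]

/-- The coordinate expression of the covector field `α` in the chart at `p`: the pullback of `α`
by the inverse of the chart. -/
noncomputable def chartForm (p : M) (α : (x : M) → TangentSpace (𝓡 D) x →L[ℝ] ℝ)
    (y : EuclideanSpace ℝ (Fin D)) : EuclideanSpace ℝ (Fin D) →L[ℝ] ℝ :=
  (α ((extChartAt (𝓡 D) p).symm y)).comp
    (mfderiv 𝓘(ℝ, EuclideanSpace ℝ (Fin D)) (𝓡 D) (extChartAt (𝓡 D) p).symm y)

/-- The coordinate expression of the vector field `X` in the chart at `p`. -/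
noncomputable def chartRep (p : M) (X : (x : M) → TangentSpace (𝓡 D) x) :
    EuclideanSpace ℝ (Fin D) → EuclideanSpace ℝ (Fin D) :=
  VectorField.mpullback 𝓘(ℝ, EuclideanSpace ℝ (Fin D)) (𝓡 D) (extChartAt (𝓡 D) p).symm X

/-- The vector field with constant coordinates `e` in the chart at `p`. It is meaningful on the
domain of that chart only. -/
noncomputable def chartField (p : M) (e : EuclideanSpace ℝ (Fin D)) (x : M) :
    TangentSpace (𝓡 D) x :=
  VectorField.mpullback (𝓡 D) 𝓘(ℝ, EuclideanSpace ℝ (Fin D)) (extChartAt (𝓡 D) p)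
    (fun _ => e) x

theorem isInvertible_mfderiv_extChartAt_symm {p : M} {y : EuclideanSpace ℝ (Fin D)}
    (hy : y ∈ (extChartAt (𝓡 D) p).target) :
    (mfderiv 𝓘(ℝ, EuclideanSpace ℝ (Fin D)) (𝓡 D) (extChartAt (𝓡 D) p).symm y).IsInvertible := by
  have := isInvertible_mfderivWithin_extChartAt_symm (I := 𝓡 D) hy
  rwa [ModelWithCorners.range_eq_univ, mfderivWithin_univ] at this

theorem contMDiffAt_extChartAt_symm {p : M} {y : EuclideanSpace ℝ (Fin D)}
    (hy : y ∈ (extChartAt (𝓡 D) p).target) :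
    ContMDiffAt 𝓘(ℝ, EuclideanSpace ℝ (Fin D)) (𝓡 D) ∞ (extChartAt (𝓡 D) p).symm y :=
  (contMDiffOn_extChartAt_symm p).contMDiffAt ((isOpen_extChartAt_target p).mem_nhds hy)

theorem mfderiv_chartRep {p : M} {y : EuclideanSpace ℝ (Fin D)}
    (hy : y ∈ (extChartAt (𝓡 D) p).target) (X : (x : M) → TangentSpace (𝓡 D) x) :
    mfderiv 𝓘(ℝ, EuclideanSpace ℝ (Fin D)) (𝓡 D) (extChartAt (𝓡 D) p).symm y
      (chartRep p X y) = X ((extChartAt (𝓡 D) p).symm y) :=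
  (isInvertible_mfderiv_extChartAt_symm hy).self_apply_inverse _

theorem chartForm_chartRep {p : M} {y : EuclideanSpace ℝ (Fin D)}
    (hy : y ∈ (extChartAt (𝓡 D) p).target) (α : (x : M) → TangentSpace (𝓡 D) x →L[ℝ] ℝ)
    (X : (x : M) → TangentSpace (𝓡 D) x) :
    chartForm p α y (chartRep p X y) =
      α ((extChartAt (𝓡 D) p).symm y) (X ((extChartAt (𝓡 D) p).symm y)) :=
  congrArg (α _) (mfderiv_chartRep hy X)

theorem contDiffAt_chartRep {p x : M} (hx : x ∈ (extChartAt (𝓡 D) p).source)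
    {X : (x : M) → TangentSpace (𝓡 D) x} (hX : SmoothFieldAt X x) :
    ContDiffAt ℝ ∞ (chartRep p X) (extChartAt (𝓡 D) p x) := by
  have hy := (extChartAt (𝓡 D) p).map_source hx
  refine contMDiffAt_vectorSpace_iff_contDiffAt.1 (ContMDiffAt.mpullback_vectorField_preimage
    (n := ∞) ?_ (contMDiffAt_extChartAt_symm hy) (isInvertible_mfderiv_extChartAt_symm hy)
    (by simp))
  rwa [(extChartAt (𝓡 D) p).left_inv hx]

theorem smoothFieldAt_chartField {p x : M} (hx : x ∈ (extChartAt (𝓡 D) p).source)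
    (e : EuclideanSpace ℝ (Fin D)) : SmoothFieldAt (chartField p e) x :=
  ContMDiffAt.mpullback_vectorField_preimage (n := ∞)
    (contMDiffAt_vectorSpace_iff_contDiffAt.2 contDiffAt_const)
    (contMDiffAt_extChartAt' (by simpa using hx)) (isInvertible_mfderiv_extChartAt hx) (by simp)

theorem mfderiv_extChartAt_symm_apply {p x : M} (hx : x ∈ (extChartAt (𝓡 D) p).source)
    (e : EuclideanSpace ℝ (Fin D)) :
    mfderiv 𝓘(ℝ, EuclideanSpace ℝ (Fin D)) (𝓡 D) (extChartAt (𝓡 D) p).symm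
      (extChartAt (𝓡 D) p x) e = chartField p e x := by
  have h := mfderiv_extChartAt_comp_mfderivWithin_extChartAt_symm' (I := 𝓡 D) hx
  rw [ModelWithCorners.range_eq_univ, mfderivWithin_univ] at h
  refine (((isInvertible_mfderiv_extChartAt hx).inverse_apply_eq).2 ?_).symm
  exact (DFunLike.congr_fun h e).symm

theorem exists_chartField_eq {p x : M} (hx : x ∈ (extChartAt (𝓡 D) p).source)
    (v : TangentSpace (𝓡 D) x) : ∃ e, chartField p e x = v :=
  ⟨mfderiv (𝓡 D) 𝓘(ℝ, EuclideanSpace ℝ (Fin D)) (extChartAt (𝓡 D) p) x v,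
   (isInvertible_mfderiv_extChartAt hx).inverse_apply_self _⟩

theorem exists_smoothFieldAt_eq {x : M} (v : TangentSpace (𝓡 D) x) :
    ∃ X : (x : M) → TangentSpace (𝓡 D) x, SmoothFieldAt X x ∧ X x = v := by
  obtain ⟨e, he⟩ := exists_chartField_eq (mem_extChartAt_source (I := 𝓡 D) x) v
  exact ⟨_, smoothFieldAt_chartField (mem_extChartAt_source x) e, he⟩

theorem chartRep_chartField {p x : M} (hx : x ∈ (extChartAt (𝓡 D) p).source)
    (e : EuclideanSpace ℝ (Fin D)) :
    chartRep p (chartField p e) (extChartAt (𝓡 D) p x) = e := by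
  have hy := (extChartAt (𝓡 D) p).map_source hx
  refine ((isInvertible_mfderiv_extChartAt_symm hy).inverse_apply_eq).2 ?_
  rw [(extChartAt (𝓡 D) p).left_inv hx]
  exact (mfderiv_extChartAt_symm_apply hx e).symm

theorem dirDeriv_eq_fderiv {p x : M} (hx : x ∈ (extChartAt (𝓡 D) p).source)
    (X : (x : M) → TangentSpace (𝓡 D) x) {h : M → ℝ}
    (hh : DifferentiableAt ℝ (h ∘ (extChartAt (𝓡 D) p).symm) (extChartAt (𝓡 D) p x)) :
    dirDeriv X h x = fderiv ℝ (h ∘ (extChartAt (𝓡 D) p).symm) (extChartAt (𝓡 D) p x)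
      (chartRep p X (extChartAt (𝓡 D) p x)) := by
  have hy := (extChartAt (𝓡 D) p).map_source hx
  have hm : MDifferentiableAt (𝓡 D) 𝓘(ℝ) h x :=
    (hh.mdifferentiableAt.comp x (mdifferentiableAt_extChartAt
      (by simpa using hx))).congr_of_eventuallyEq <| by
        filter_upwards [(isOpen_extChartAt_source p).mem_nhds hx] with y hy
        exact (congrArg h ((extChartAt (𝓡 D) p).left_inv hy)).symm
  rw [← (extChartAt (𝓡 D) p).left_inv hx] at hm
  have h1 := mvfderiv_comp_apply (extChartAt (𝓡 D) p x) hm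
    ((contMDiffAt_extChartAt_symm hy).mdifferentiableAt (by simp))
    (chartRep p X (extChartAt (𝓡 D) p x))
  rw [mfderiv_chartRep hy, (extChartAt (𝓡 D) p).left_inv hx] at h1
  rw [dirDeriv, ← h1, mvfderiv, mfderiv_eq_fderiv]
  rfl

theorem mlieBracket_eq_lieBracket {E : Type*} [NormedAddCommGroup E] [NormedSpace ℝ E]
    (V W : (x : E) → TangentSpace 𝓘(ℝ, E) x) :
    VectorField.mlieBracket 𝓘(ℝ, E) V W = VectorField.lieBracket ℝ V W := by
  rw [← VectorField.mlieBracketWithin_univ, VectorField.mlieBracketWithin_eq_lieBracketWithin]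
  exact VectorField.lieBracketWithin_univ

theorem chartForm_mlieBracket {p x : M} (hx : x ∈ (extChartAt (𝓡 D) p).source)
    (α : (x : M) → TangentSpace (𝓡 D) x →L[ℝ] ℝ)
    {X Z : (x : M) → TangentSpace (𝓡 D) x} (hX : SmoothFieldAt X x) (hZ : SmoothFieldAt Z x) :
    α x (VectorField.mlieBracket (𝓡 D) X Z x) =
      chartForm p α (extChartAt (𝓡 D) p x)
        (VectorField.lieBracket ℝ (chartRep p X) (chartRep p Z) (extChartAt (𝓡 D) p x)) := by
  have hy := (extChartAt (𝓡 D) p).map_source hx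
  have : IsManifold (𝓡 D) (minSmoothness ℝ 2) M := by
    rw [minSmoothness_of_isRCLikeNormedField]
    exact IsManifold.of_le (n := ∞) (by decide)
  have hb := VectorField.mpullback_mlieBracket (V := X) (W := Z) (n := ∞)
    (I := 𝓘(ℝ, EuclideanSpace ℝ (Fin D))) (x₀ := extChartAt (𝓡 D) p x)
    (f := (extChartAt (𝓡 D) p).symm)
    (by rw [(extChartAt (𝓡 D) p).left_inv hx]; exact hX.mdifferentiableAt (by simp))
    (by rw [(extChartAt (𝓡 D) p).left_inv hx]; exact hZ.mdifferentiableAt (by simp))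
    (contMDiffAt_extChartAt_symm hy)
    (by rw [minSmoothness_of_isRCLikeNormedField]; decide)
  have h2 := chartForm_chartRep hy α (VectorField.mlieBracket (𝓡 D) X Z)
  rw [(extChartAt (𝓡 D) p).left_inv hx] at h2
  exact h2.symm.trans (congrArg _ (hb.trans (congrFun (mlieBracket_eq_lieBracket _ _) _)))

/-- In a chart with coordinate expression `ω` of `α`, the exterior derivative `dα(X, Z)` is
`(D_X ω)(Z) - (D_Z ω)(X)`. The terms that contain derivatives of `X` and `Z` cancel against the
Lie bracket. -/
theorem extDerivOne_eq_fderiv_chartForm {p x : M} (hx : x ∈ (extChartAt (𝓡 D) p).source)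
    {α : (x : M) → TangentSpace (𝓡 D) x →L[ℝ] ℝ}
    (hα : DifferentiableAt ℝ (chartForm p α) (extChartAt (𝓡 D) p x))
    {X Z : (x : M) → TangentSpace (𝓡 D) x} (hX : SmoothFieldAt X x) (hZ : SmoothFieldAt Z x) :
    extDerivOne α X Z x =
      fderiv ℝ (chartForm p α) (extChartAt (𝓡 D) p x) (chartRep p X (extChartAt (𝓡 D) p x))
        (chartRep p Z (extChartAt (𝓡 D) p x))
      - fderiv ℝ (chartForm p α) (extChartAt (𝓡 D) p x) (chartRep p Z (extChartAt (𝓡 D) p x))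
        (chartRep p X (extChartAt (𝓡 D) p x)) := by
  have hy := (extChartAt (𝓡 D) p).map_source hx
  have key : ∀ {Y W : (x : M) → TangentSpace (𝓡 D) x}, SmoothFieldAt Y x →
      dirDeriv W (fun y => α y (Y y)) x =
        fderiv ℝ (chartForm p α) (extChartAt (𝓡 D) p x) (chartRep p W (extChartAt (𝓡 D) p x))
          (chartRep p Y (extChartAt (𝓡 D) p x))
        + chartForm p α (extChartAt (𝓡 D) p x)
          (fderiv ℝ (chartRep p Y) (extChartAt (𝓡 D) p x)
            (chartRep p W (extChartAt (𝓡 D) p x))) := by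
    intro Y W hY
    have hd : DifferentiableAt ℝ (chartRep p Y) (extChartAt (𝓡 D) p x) :=
      (contDiffAt_chartRep hx hY).differentiableAt (by simp)
    have he : (fun y => α y (Y y)) ∘ (extChartAt (𝓡 D) p).symm
        =ᶠ[𝓝 (extChartAt (𝓡 D) p x)] fun y => chartForm p α y (chartRep p Y y) := by
      filter_upwards [(isOpen_extChartAt_target p).mem_nhds hy] with y hy
      exact (chartForm_chartRep hy α Y).symm
    rw [dirDeriv_eq_fderiv hx W ((hα.clm_apply hd).congr_of_eventuallyEq he), he.fderiv_eq,
      fderiv_clm_apply hα hd]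
    simp [add_comm]
  rw [extDerivOne, key hZ, key hX, chartForm_mlieBracket hx α hX hZ, VectorField.lieBracket,
    map_sub]
  ring

theorem chartForm_mvfderiv {p : M} {y : EuclideanSpace ℝ (Fin D)}
    (hy : y ∈ (extChartAt (𝓡 D) p).target) {f : M → ℝ}
    (hf : MDifferentiableAt (𝓡 D) 𝓘(ℝ) f ((extChartAt (𝓡 D) p).symm y)) :
    chartForm p (mvfderiv (𝓡 D) f) y = fderiv ℝ (f ∘ (extChartAt (𝓡 D) p).symm) y := by
  have h1 := mvfderiv_comp y hf ((contMDiffAt_extChartAt_symm hy).mdifferentiableAt (by simp))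
  refine h1.symm.trans ?_
  rw [mvfderiv, mfderiv_eq_fderiv]
  rfl

theorem contDiffAt_comp_extChartAt_symm {p x : M} (hx : x ∈ (extChartAt (𝓡 D) p).source)
    {f : M → ℝ} (hf : ContMDiffAt (𝓡 D) 𝓘(ℝ) ∞ f x) :
    ContDiffAt ℝ ∞ (f ∘ (extChartAt (𝓡 D) p).symm) (extChartAt (𝓡 D) p x) := by
  refine ContMDiffAt.contDiffAt (ContMDiffAt.comp (I' := 𝓡 D) _ ?_
    (contMDiffAt_extChartAt_symm ((extChartAt (𝓡 D) p).map_source hx)))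
  rwa [(extChartAt (𝓡 D) p).left_inv hx]

theorem chartForm_mvfderiv_eventuallyEq {p x : M} (hx : x ∈ (extChartAt (𝓡 D) p).source)
    {U : Set M} (hU : IsOpen U) (hxU : x ∈ U) {f : M → ℝ} (hf : ContMDiffOn (𝓡 D) 𝓘(ℝ) ∞ f U) :
    chartForm p (mvfderiv (𝓡 D) f) =ᶠ[𝓝 (extChartAt (𝓡 D) p x)]
      fderiv ℝ (f ∘ (extChartAt (𝓡 D) p).symm) := by
  have hy := (extChartAt (𝓡 D) p).map_source hx
  have hc : ∀ᶠ y in 𝓝 (extChartAt (𝓡 D) p x), (extChartAt (𝓡 D) p).symm y ∈ U :=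
    (continuousAt_extChartAt_symm'' hy).eventually_mem (by
      rw [(extChartAt (𝓡 D) p).left_inv hx]
      exact hU.mem_nhds hxU)
  filter_upwards [hc, (isOpen_extChartAt_target p).mem_nhds hy] with y h1 h2
  exact chartForm_mvfderiv h2 ((hf.contMDiffAt (hU.mem_nhds h1)).mdifferentiableAt (by simp))

theorem contMDiffAt_dirDeriv_chartField {p x : M} (hx : x ∈ (extChartAt (𝓡 D) p).source)
    {U : Set M} (hU : IsOpen U) (hxU : x ∈ U) {f : M → ℝ}
    (hf : ContMDiffOn (𝓡 D) 𝓘(ℝ) ∞ f U) (e : EuclideanSpace ℝ (Fin D)) :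
    ContMDiffAt (𝓡 D) 𝓘(ℝ) ∞ (dirDeriv (chartField p e) f) x := by
  have h1 : ContDiffAt ℝ ∞ (fun y => fderiv ℝ (f ∘ (extChartAt (𝓡 D) p).symm) y e)
      (extChartAt (𝓡 D) p x) :=
    ((contDiffAt_comp_extChartAt_symm hx (hf.contMDiffAt (hU.mem_nhds hxU))).fderiv_right
      (by simp)).clm_apply contDiffAt_const
  refine (h1.contMDiffAt.comp x
    (contMDiffAt_extChartAt' (by simpa using hx))).congr_of_eventuallyEq ?_
  filter_upwards [hU.mem_nhds hxU, (isOpen_extChartAt_source p).mem_nhds hx] with y hyU hy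
  rw [dirDeriv_eq_fderiv hy _ ((contDiffAt_comp_extChartAt_symm hy
    (hf.contMDiffAt (hU.mem_nhds hyU))).differentiableAt (by simp)), chartRep_chartField hy]
  rfl

/-! ### Closed and exact covector fields -/

/-- `d(df) = 0`, by the symmetry of second derivatives. -/
theorem extDerivOne_mvfderiv {U : Set M} (hU : IsOpen U) {f : M → ℝ}
    (hf : ContMDiffOn (𝓡 D) 𝓘(ℝ) ∞ f U) {x : M} (hx : x ∈ U)
    {X Z : (x : M) → TangentSpace (𝓡 D) x} (hX : SmoothFieldAt X x) (hZ : SmoothFieldAt Z x) :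
    extDerivOne (mvfderiv (𝓡 D) f) X Z x = 0 := by
  have hxs := mem_extChartAt_source (I := 𝓡 D) x
  have h1 := contDiffAt_comp_extChartAt_symm hxs (hf.contMDiffAt (hU.mem_nhds hx))
  have h2 := chartForm_mvfderiv_eventuallyEq hxs hU hx hf
  have h3 : ContDiffAt ℝ ∞ (fderiv ℝ (f ∘ (extChartAt (𝓡 D) x).symm)) (extChartAt (𝓡 D) x x) :=
    h1.fderiv_right (by simp)
  rw [extDerivOne_eq_fderiv_chartForm hxs ((h3.differentiableAt (by simp)).congr_of_eventuallyEq h2)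
    hX hZ, h2.fderiv_eq, sub_eq_zero]
  exact (h1.isSymmSndFDerivAt (by simp; decide)) _ _

/-- Poincaré lemma: a smooth closed covector field is locally the differential of a smooth function.
Smoothness of `α` is expressed by that of `α(X)` for smooth vector fields `X`. -/
theorem exists_mvfderiv_eq_of_extDerivOne_eq_zero {U : Set M} (hU : IsOpen U) {p : M} (hp : p ∈ U)
    {α : (x : M) → TangentSpace (𝓡 D) x →L[ℝ] ℝ}
    (hα : ∀ x ∈ U, ∀ X : (x : M) → TangentSpace (𝓡 D) x, SmoothFieldAt X x →
      ContMDiffAt (𝓡 D) 𝓘(ℝ) ∞ (fun y => α y (X y)) x)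
    (hd : ∀ x ∈ U, ∀ X Z : (x : M) → TangentSpace (𝓡 D) x, SmoothFieldAt X x →
      SmoothFieldAt Z x → extDerivOne α X Z x = 0) :
    ∃ (V : Set M) (f : M → ℝ), IsOpen V ∧ p ∈ V ∧ V ⊆ U ∧ ContMDiffOn (𝓡 D) 𝓘(ℝ) ∞ f V ∧
      ∀ x ∈ V, mvfderiv (𝓡 D) f x = α x := by
  have hps := mem_extChartAt_source (I := 𝓡 D) p
  have hyt := mem_extChartAt_target (I := 𝓡 D) p
  have hopen := (continuousOn_extChartAt_symm (I := 𝓡 D) p).isOpen_inter_preimage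
    (isOpen_extChartAt_target p) hU
  obtain ⟨r, hr, hball⟩ := Metric.isOpen_iff.1 hopen (extChartAt (𝓡 D) p p)
    ⟨hyt, by simpa using hp⟩
  set B := Metric.ball (extChartAt (𝓡 D) p p) r
  have hsm : ContDiffOn ℝ ∞ (chartForm p α) B := by
    rw [contDiffOn_clm_apply]
    intro e y hy
    obtain ⟨hy1, hy2⟩ := hball hy
    have hys := (extChartAt (𝓡 D) p).map_target hy1
    have h1 := (hα _ hy2 (chartField p e) (smoothFieldAt_chartField hys e)).comp y
      (contMDiffAt_extChartAt_symm hy1)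
    refine (h1.contDiffAt.congr_of_eventuallyEq ?_).contDiffWithinAt
    filter_upwards [(isOpen_extChartAt_target p).mem_nhds hy1] with z hz
    have := mfderiv_extChartAt_symm_apply ((extChartAt (𝓡 D) p).map_target hz) e
    rw [(extChartAt (𝓡 D) p).right_inv hz] at this
    exact congrArg (α _) this
  have hsymm : ∀ y ∈ B, ∀ u v, fderiv ℝ (chartForm p α) y u v = fderiv ℝ (chartForm p α) y v u := by
    intro y hy u v
    obtain ⟨hy1, hy2⟩ := hball hy
    have hys := (extChartAt (𝓡 D) p).map_target hy1
    have hrep : ∀ e, chartRep p (chartField p e) y = e := fun e => by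
      simpa only [(extChartAt (𝓡 D) p).right_inv hy1] using chartRep_chartField hys e
    have h0 := hd _ hy2 _ _ (smoothFieldAt_chartField hys u) (smoothFieldAt_chartField hys v)
    rw [extDerivOne_eq_fderiv_chartForm hys, (extChartAt (𝓡 D) p).right_inv hy1, hrep, hrep] at h0
    · exact sub_eq_zero.1 h0
    · rw [(extChartAt (𝓡 D) p).right_inv hy1]
      exact (hsm.contDiffAt (Metric.isOpen_ball.mem_nhds hy)).differentiableAt (by simp)
    · exact smoothFieldAt_chartField hys u
    · exact smoothFieldAt_chartField hys v
  obtain ⟨F, hF⟩ := Convex.exists_forall_hasFDerivAt_of_fderiv_symmetric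
    (convex_ball (extChartAt (𝓡 D) p p) r) Metric.isOpen_ball (hsm.differentiableOn (by simp)) hsymm
  have hFs : ContDiffOn ℝ ∞ F B := by
    rw [contDiffOn_infty_iff_fderiv_of_isOpen Metric.isOpen_ball]
    exact ⟨fun y hy => (hF y hy).differentiableAt.differentiableWithinAt,
      hsm.congr fun y hy => (hF y hy).fderiv⟩
  refine ⟨(extChartAt (𝓡 D) p).source ∩ extChartAt (𝓡 D) p ⁻¹' B, F ∘ extChartAt (𝓡 D) p,
    (continuousOn_extChartAt p).isOpen_inter_preimage (isOpen_extChartAt_source p)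
      Metric.isOpen_ball, ⟨hps, Metric.mem_ball_self hr⟩, ?_, ?_, ?_⟩
  · rintro x ⟨hx1, hx2⟩
    have := (hball hx2).2
    rwa [Set.mem_preimage, (extChartAt (𝓡 D) p).left_inv hx1] at this
  · rintro x ⟨hx1, hx2⟩
    exact (((hFs.contDiffAt (Metric.isOpen_ball.mem_nhds hx2)).contMDiffAt).comp x
      (contMDiffAt_extChartAt' (by simpa using hx1))).contMDiffWithinAt
  · rintro x ⟨hx1, hx2⟩
    ext v
    obtain ⟨e, rfl⟩ := exists_chartField_eq hx1 v
    have hm := mvfderiv_comp_apply x (hF _ hx2).differentiableAt.mdifferentiableAt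
      (mdifferentiableAt_extChartAt (I := 𝓡 D) (by simpa using hx1)) (chartField p e x)
    have h1 : mfderiv (𝓡 D) 𝓘(ℝ, EuclideanSpace ℝ (Fin D)) (extChartAt (𝓡 D) p) x
      (chartField p e x) = e := (isInvertible_mfderiv_extChartAt hx1).self_apply_inverse e
    have h2 : mvfderiv 𝓘(ℝ, EuclideanSpace ℝ (Fin D)) F (extChartAt (𝓡 D) p x) e =
        chartForm p α (extChartAt (𝓡 D) p x) e := by
      rw [mvfderiv, mfderiv_eq_fderiv, (hF _ hx2).fderiv]
      rfl
    -- All tangent spaces are the model space, so covectors at equal points can be compared.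
    have h3 : ∀ z, z = x → ∀ w : EuclideanSpace ℝ (Fin D), α z w = α x w := by
      rintro _ rfl w
      rfl
    exact (hm.trans ((congrArg _ h1).trans h2)).trans
      ((h3 _ ((extChartAt (𝓡 D) p).left_inv hx1) _).trans
        (congrArg (α x) (mfderiv_extChartAt_symm_apply hx1 e)))

end Charts

/-! ### Null Killing vector fields of Lorentzian metrics -/

namespace LorentzianMetric

variable {D : ℕ} {M : Type*} [TopologicalSpace M] [ChartedSpace (EuclideanSpace ℝ (Fin D)) M]
  [IsManifold (𝓡 D) ∞ M] (g : LorentzianMetric D M)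

/-- Nondegeneracy of a Lorentzian metric: a vector orthogonal to all vectors is orthogonal to a
timelike one, on whose complement the metric is positive definite. -/
theorem exists_form_pos {x : M} {v : TangentSpace (𝓡 D) x} (hv : v ≠ 0) :
    ∃ w, 0 < g.form x v w := by
  by_contra! h
  have h0 : ∀ w, g.form x v w = 0 := fun w =>
    le_antisymm (h w) (by have := h (-w); rw [map_neg] at this; linarith)
  obtain ⟨t, -, ht⟩ := g.signature x
  exact absurd (h0 v) (ht v (by rw [g.symm, h0]) hv).ne'

theorem contMDiffAt_pairing {X Y : (x : M) → TangentSpace (𝓡 D) x} {x : M}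
    (hX : SmoothFieldAt X x) (hY : SmoothFieldAt Y x) :
    ContMDiffAt (𝓡 D) 𝓘(ℝ) ∞ (pairing g.form X Y) x := by
  have := ContMDiffAt.clm_bundle_apply₂ (F₁ := EuclideanSpace ℝ (Fin D))
    (F₂ := EuclideanSpace ℝ (Fin D)) (F₃ := ℝ) (E₃ := Bundle.Trivial M ℝ) (b := fun x => x)
    (v := X) (w := Y) (ψ := g.form) g.smooth.contMDiffAt hX hY
  rw [Bundle.contMDiffAt_totalSpace] at this
  exact this.2

/-- Near every point, the covector field dual to a hypersurface-orthogonal null vector field `ξ` is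
a positive multiple of a differential: `df = c g(ξ, ·)` with `c > 0` smooth. -/
theorem exists_eq_smul_mvfderiv {ξ : (x : M) → TangentSpace (𝓡 D) x}
    (hξ : ∀ x, SmoothFieldAt ξ x) (hn : g.IsNull ξ) (ho : g.IsHypersurfaceOrthogonal ξ) (p : M) :
    ∃ (U : Set M) (f c : M → ℝ), IsOpen U ∧ p ∈ U ∧ ContMDiffOn (𝓡 D) 𝓘(ℝ) ∞ f U ∧
      ContMDiffOn (𝓡 D) 𝓘(ℝ) ∞ c U ∧ (∀ x ∈ U, 0 < c x) ∧
      ∀ x ∈ U, mvfderiv (𝓡 D) f x = c x • g.form x (ξ x) := by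
  obtain ⟨U, f₀, hU, hpU, hf₀, hort₀⟩ := ho p
  have hps := mem_extChartAt_source (I := 𝓡 D) p
  obtain ⟨w, hw⟩ := g.exists_form_pos (hn p).1
  obtain ⟨e, rfl⟩ := exists_chartField_eq hps w
  -- The defining function is replaced by its negative if necessary, to make `c` positive.
  obtain ⟨f, hf, hort, hpos⟩ : ∃ f : M → ℝ, ContMDiffOn (𝓡 D) 𝓘(ℝ) ∞ f U ∧
      (∀ x ∈ U, ∀ v : TangentSpace (𝓡 D) x, mvfderiv (𝓡 D) f x v = 0 → g.form x (ξ x) v = 0) ∧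
      0 < dirDeriv (chartField p e) f p := by
    rcases lt_trichotomy (dirDeriv (chartField p e) f₀ p) 0 with h | h | h
    · refine ⟨-f₀, hf₀.neg, fun x hx v hv => (hort₀ x hx).2 v ?_, ?_⟩
      · rw [mvfderiv_neg] at hv
        simpa using hv
      · rw [dirDeriv, mvfderiv_neg]
        exact neg_pos.2 h
    · exact absurd ((hort₀ p hpU).2 _ h) hw.ne'
    · exact ⟨f₀, hf₀, fun x hx => (hort₀ x hx).2, h⟩
  have hα : ∀ x ∈ (extChartAt (𝓡 D) p).source,
      ContMDiffAt (𝓡 D) 𝓘(ℝ) ∞ (pairing g.form ξ (chartField p e)) x := fun x hx =>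
    g.contMDiffAt_pairing (hξ x) (smoothFieldAt_chartField hx e)
  have hdf : ∀ x ∈ (extChartAt (𝓡 D) p).source, x ∈ U →
      ContMDiffAt (𝓡 D) 𝓘(ℝ) ∞ (dirDeriv (chartField p e) f) x := fun x hx hxU =>
    contMDiffAt_dirDeriv_chartField hx hU hxU hf e
  obtain ⟨V, hVprop, hV, hpV⟩ := eventually_nhds_iff.1
    ((hU.eventually_mem hpU).and (((isOpen_extChartAt_source p).eventually_mem hps).and
      (((hα p hps).continuousAt.eventually_const_lt hw).and
        ((hdf p hps hpU).continuousAt.eventually_const_lt hpos))))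
  refine ⟨V, f, fun x => dirDeriv (chartField p e) f x / pairing g.form ξ (chartField p e) x,
    hV, hpV, hf.mono fun x hx => (hVprop x hx).1, ?_, ?_, ?_⟩
  · intro x hx
    obtain ⟨h1, h2, h3, h4⟩ := hVprop x hx
    exact ((hdf x h2 h1).div₀ (hα x h2) h3.ne').contMDiffWithinAt
  · intro x hx
    obtain ⟨h1, h2, h3, h4⟩ := hVprop x hx
    exact div_pos h4 h3
  · intro x hx
    obtain ⟨h1, h2, h3, h4⟩ := hVprop x hx
    ext v
    -- The component of `v` in `ker df`, for the splitting of the tangent space by the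
    -- coordinate field, is orthogonal to `ξ`.
    have h5 := hort x h1
      (v - (mvfderiv (𝓡 D) f x v / dirDeriv (chartField p e) f x) • chartField p e x) (by
        rw [map_sub, map_smul, smul_eq_mul, ← dirDeriv, div_mul_cancel₀ _ h4.ne', sub_self])
    rw [map_sub, map_smul, smul_eq_mul, sub_eq_zero] at h5
    change 0 < g.form x (ξ x) (chartField p e x) at h3
    change _ = (_ / g.form x (ξ x) (chartField p e x)) * g.form x (ξ x) v
    rw [h5]
    field_simp

/-- If `ξ` is null and Killing and `df = c g(ξ, ·)`, then `ξ c = 0`: since `df(ξ) = 0`, the form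
`df` is invariant under `ξ`, and so is `g(ξ, ·)`. -/
theorem dirDeriv_eq_zero_of_isKilling {ξ : (x : M) → TangentSpace (𝓡 D) x}
    (hξ : ∀ x, SmoothFieldAt ξ x) (hn : g.IsNull ξ) (hk : g.IsKilling ξ)
    {U : Set M} (hU : IsOpen U) {f c : M → ℝ} (hf : ContMDiffOn (𝓡 D) 𝓘(ℝ) ∞ f U)
    (hc : ContMDiffOn (𝓡 D) 𝓘(ℝ) ∞ c U)
    (hfc : ∀ x ∈ U, mvfderiv (𝓡 D) f x = c x • g.form x (ξ x)) {x : M} (hx : x ∈ U) :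
    dirDeriv ξ c x = 0 := by
  obtain ⟨w, hw⟩ := g.exists_form_pos (hn x).1
  obtain ⟨X, hX, rfl⟩ := exists_smoothFieldAt_eq w
  have h1 := extDerivOne_mvfderiv hU hf hx (hξ x) hX
  have h2 : (fun y => mvfderiv (𝓡 D) f y (X y)) =ᶠ[𝓝 x] fun y => c y * pairing g.form ξ X y := by
    filter_upwards [hU.mem_nhds hx] with y hy
    rw [hfc y hy]
    rfl
  have h3 : (fun y => mvfderiv (𝓡 D) f y (ξ y)) =ᶠ[𝓝 x] fun y => 0 := by
    filter_upwards [hU.mem_nhds hx] with y hy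
    rw [hfc y hy]
    exact (congrArg (c y * ·) (hn y).2).trans (mul_zero _)
  -- The Killing equation for the pair `ξ, X` says that `ξ (g(ξ, X)) = g(ξ, [ξ, X])`.
  have h4 := hk x ξ X (hξ x) hX
  rw [lieDerivForm, VectorField.mlieBracket_self] at h4
  rw [extDerivOne, dirDeriv_congr h2, dirDeriv_congr h3, hfc x hx,
    dirDeriv_mul ((hc.contMDiffAt (hU.mem_nhds hx)).mdifferentiableAt (by simp))
      ((g.contMDiffAt_pairing (hξ x) hX).mdifferentiableAt (by simp))] at h1
  have h5 : dirDeriv X (fun _ : M => (0 : ℝ)) x = 0 := by simp [dirDeriv, mvfderiv_const]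
  rw [h5] at h1
  simp only [Pi.zero_apply, map_zero, zero_apply, smul_apply, smul_eq_mul, pairing] at h1 h4
  have h6 : g.form x (ξ x) (X x) * dirDeriv ξ c x = 0 := by
    linear_combination h1 - c x * h4
  exact (mul_eq_zero.1 h6).resolve_left hw.ne'

theorem isConformallyParallel_of_isKilling {ξ : (x : M) → TangentSpace (𝓡 D) x}
    (hξ : ∀ x, SmoothFieldAt ξ x) (hn : g.IsNull ξ) (hk : g.IsKilling ξ)
    (ho : g.IsHypersurfaceOrthogonal ξ) : g.IsConformallyParallel ξ := by
  intro p
  obtain ⟨U, f, c, hU, hpU, hf, hc, hpos, hfc⟩ := g.exists_eq_smul_mvfderiv hξ hn ho p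
  refine ⟨U, fun x => (c x)⁻¹, hU, hpU, ?_, fun x hx => inv_pos.2 (hpos x hx), ?_⟩
  · exact fun x hx => (hc x hx).inv₀ (hpos x hx).ne'
  · intro x hx X hX Z hZ
    simp only [inv_inv]
    rw [koszul_eq_lieDerivForm_add_extDerivOne (fun y v w => by simp [g.symm y v w]),
      lieDerivForm_smul ((hc.contMDiffAt (hU.mem_nhds hx)).mdifferentiableAt (by simp))
        ((g.contMDiffAt_pairing hX hZ).mdifferentiableAt (by simp)),
      hk x X Z hX hZ, g.dirDeriv_eq_zero_of_isKilling hξ hn hk hU hf hc hfc hx]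
    have h := extDerivOne_congr (X := X) (Z := Z) <| by
      filter_upwards [hU.mem_nhds hx] with y hy using hfc y hy
    rw [extDerivOne_mvfderiv hU hf hx hX hZ] at h
    simp only [smul_apply, ← h]
    simp

theorem isHypersurfaceOrthogonal_of_isConformallyParallel {ξ : (x : M) → TangentSpace (𝓡 D) x}
    (hξ : ∀ x, SmoothFieldAt ξ x) (hn : g.IsNull ξ) (hp : g.IsConformallyParallel ξ) :
    g.IsHypersurfaceOrthogonal ξ := by
  intro p
  obtain ⟨U, Ω, hU, hpU, hΩ, hpos, hpar⟩ := hp p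
  have hsymm : ∀ x (v w : TangentSpace (𝓡 D) x),
      ((Ω x)⁻¹ • g.form x) v w = ((Ω x)⁻¹ • g.form x) w v := fun y v w => by simp [g.symm y v w]
  obtain ⟨V, f, hV, hpV, hVU, hf, hfα⟩ := exists_mvfderiv_eq_of_extDerivOne_eq_zero hU hpU
    (α := fun x => ((Ω x)⁻¹ • g.form x) (ξ x))
    (fun x hx X hX =>
      ((hΩ.contMDiffAt (hU.mem_nhds hx)).inv₀ (hpos x hx).ne').mul
        (g.contMDiffAt_pairing (hξ x) hX))
    (fun x hx X Z hX hZ => by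
      -- Exchanging `X` and `Z` isolates the antisymmetric part of the Koszul expression.
      have h1 := hpar x hx X hX Z hZ
      have h2 := hpar x hx Z hZ X hX
      rw [koszul_eq_lieDerivForm_add_extDerivOne hsymm] at h1 h2
      rw [lieDerivForm_swap hsymm, extDerivOne_swap] at h2
      simp only [map_zero, zero_apply, mul_zero] at h1 h2
      linarith)
  refine ⟨V, f, hV, hpV, hf, fun x hx => ⟨fun h0 => ?_, fun v hv => ?_⟩⟩
  · obtain ⟨w, hw⟩ := g.exists_form_pos (hn x).1
    have h1 := DFunLike.congr_fun ((hfα x hx).symm.trans h0) w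
    exact absurd h1 (mul_pos (inv_pos.2 (hpos x (hVU hx))) hw).ne'
  · rw [hfα x hx] at hv
    exact (mul_eq_zero.1 hv).resolve_left (inv_pos.2 (hpos x (hVU hx))).ne'

end LorentzianMetric

theorem proposition4p16 {D : ℕ} {M : Type*} [TopologicalSpace M]
    [ChartedSpace (EuclideanSpace ℝ (Fin D)) M] [IsManifold (𝓡 D) ∞ M]
    [T2Space M] [SecondCountableTopology M] [ConnectedSpace M] (g : LorentzianMetric D M) :
    (g.IsGravitationalWave ∧
      ∃ ξ : (x : M) → TangentSpace (𝓡 D) x, g.IsWaveVectorField ξ ∧ g.IsKilling ξ) ↔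
    g.IsPlatonicWave := by
  constructor
  · rintro ⟨-, ξ, h, hk⟩
    exact ⟨ξ, h.smooth, h.null, h.complete, hk,
      g.isConformallyParallel_of_isKilling h.smooth h.null hk h.hypersurfaceOrthogonal⟩
  · rintro ⟨ξ, hs, hn, hc, hk, hp⟩
    have h : g.IsWaveVectorField ξ :=
      ⟨hs, hn, hc, g.isHypersurfaceOrthogonal_of_isConformallyParallel hs hn hp⟩
    exact ⟨⟨ξ, h⟩, ξ, h, hk⟩
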